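/- Let $X_1,X_2,\dots$ be independent real random variables on a probability space with a common continuous distribution function $F$. For $n\ge 0$, a feasible policy $\pi_n$ for the unimodal sequential selection problem is a random set $\{\tau_1<\tau_2<\cdots<\tau_k\}\subseteq\{1,\dots,n\}$ (of random, possibly zero, size $k$) of selected indices such that, for each $1\le i\le n$, the event that $i$ is selected belongs to $\mathcal F_i=\sigma(X_1,\dots,X_i)$, and such that the selected subsequence is always unimodal: if $k\ge1$, then $$X_{\tau_1}\le X_{\tau_2}\le\cdots\le X_{\tau_t}\ge X_{\tau_{t+1}}\ge\cdots\ge X_{\tau_k}\quad\text{for some }1\le t\le k .$$ Let $\Pi(n)$ be the set of feasible policies and let $U^o_n(\pi_n)=k$ be the length of the subsequence selected by $\pi_n$. A policy $\pi^*_n\in\Pi(n)$ is optimal if $\mathbb E[U^o_n(\pi^*_n)]=\sup_{\pi_n\in\Pi(n)}\mathbb E[U^o_n(\pi_n)]$. Corollary (Weak Law for Unimodal Sequential Selections). For every $n$ an optimal policy $\pi_n^*\in\Pi(n)$ exists, and for every sequence of optimal policies $\pi_n^*\in\Pi(n)$, $$\frac{U^o_n(\pi^*_n)}{\sqrt n}\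 \xrightarrow{\ p\ }\ 2\qquad\text{as } n\to\infty .$$ -/

import Mathlib

open MeasureTheory ProbabilityTheory Filter

/-- The sequence `x`, read along the finite index set `s` in increasing order of the indices, is
unimodal: there is a turning place `t ∈ s` up to which it is nondecreasing and from which it is
nonincreasing.  Either piece may consist of the single place `t`; the empty sequence is allowed. -/
def IsUnimodalOn {n : ℕ} (x : Fin n → ℝ) (s : Finset (Fin n)) : Prop :=
  s.Nonempty → ∃ t ∈ s, MonotoneOn x {i | i ∈ s ∧ i ≤ t} ∧ AntitoneOn x {i | i ∈ s ∧ t ≤ i}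

/-- The σ-field generated by the observations `X 0, …, X i`. -/
abbrev observedSigma {Ω : Type*} (X : ℕ → Ω → ℝ) (i : ℕ) : MeasurableSpace Ω :=
  ⨆ j ≤ i, MeasurableSpace.comap (X j) inferInstance

/-- A feasible policy for the sequential selection of a unimodal subsequence of the `n`
observations `X 0, …, X (n - 1)`: whether the `i`-th observation is selected depends only on the
observations up to and including that one, and the selected subsequence is unimodal. -/
structure FeasiblePolicy {Ω : Type*} (X : ℕ → Ω → ℝ) (n : ℕ) where
  /-- the set of the indices selected by the policy -/
  selected : Ω → Finset (Fin n)
  nonanticipating : ∀ i : Fin n, MeasurableSet[observedSigma X i] {ω | i ∈ selected ω}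
  unimodal : ∀ ω, IsUnimodalOn (fun i : Fin n => X i ω) (selected ω)

/-- The length of the unimodal subsequence that is selected by the policy. -/
def FeasiblePolicy.length {Ω : Type*} {X : ℕ → Ω → ℝ} {n : ℕ} (π : FeasiblePolicy X n)
    (ω : Ω) : ℕ :=
  (π.selected ω).card

/-- A policy is optimal if it maximizes the expected length of the selected subsequence among all
feasible policies.  (The length is measurable and at most `n` as soon as the observations are
measurable, so that these expectations are genuine.) -/
def FeasiblePolicy.IsOptimal {Ω : Type*} [MeasurableSpace Ω] {X : ℕ → Ω → ℝ} {n : ℕ}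
    (π : FeasiblePolicy X n) (P : Measure Ω) : Prop :=
  ∀ ρ : FeasiblePolicy X n, ∫ ω, (ρ.length ω : ℝ) ∂P ≤ ∫ ω, (π.length ω : ℝ) ∂P

/-!
In the scale of their common distribution function the observations are independent and uniform on
`[0, 1]`, and a unimodal selection is described by a state: whether it still rises, and its last
value. With `n` observations, let `U` be the number of selections.

*Existence of an optimal policy.* The Bellman equation defines the value `value k σ` of the state
`σ` with `k` observations to come. The number of selections so far plus the value of the current
state is a supermartingale for every policy (`integral_countBefore_add_value_le`) and a martingale
for the policy that acts on the maximum in the Bellman equation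
(`integral_countBefore_bestChoice`). So the maximum of `𝔼 U` is `value n (true, 0)`.

*Upper bound.* The selection has a budget of `2`: it climbs by at most `1` and descends by at most
`1`. If a turn is charged with the whole unused climb, the cost of a uniform value dominates a
uniform variable, so that the amount by which it falls short of a price `t` is at most `t` and has
mean at most `t ^ 2 / 2` given the past. On every path `t * U` is at most `2` plus the sum of these
surpluses. With `t = 2 / √n` that sum has mean at most `2` and second moment at most `4 + 2 t`, so
that `𝔼 U ^ 2 ≤ 4 n + √n` for every policy (`integral_sq_countBefore_le`).

*Lower bound.* Rising through the first half of the observations and falling through the second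
half, each time with selection windows of the width that is best for monotone selection, gives
`√n (1 - o(1))` selections in each half. In terms of the Bellman equation, `a √(k r) - C` with
`a < √2` is a subsolution for the problem with `k` observations and room `r`
(`exists_sqrt_le_of_bellman`). Hence `𝔼 U ≥ (2 - o(1)) √n` under an optimal policy.

The first moment is nearly `2 √n` and the second one at most nearly `4 n`, so `U / √n - 2` tends to
`0` in `L²`, and therefore in probability.
-/

namespace UnimodalSelection

/-! ### The state of a unimodal selection -/

/-- The state of a selection in progress: whether the selected values have been nondecreasing so
far, and the last selected value. -/
abbrev SelState := Bool × ℝ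

/-- A value may be selected next: always while the selection rises, and afterwards only if the
value does not exceed the last selected one. -/
def CanFollow (σ : SelState) (y : ℝ) : Prop := σ.1 = true ∨ y ≤ σ.2

/-- The state after the value `y` has been selected in the state `σ`. -/
noncomputable def advance (σ : SelState) (y : ℝ) : SelState := (σ.1 && decide (σ.2 ≤ y), y)

open Classical in
/-- The state after the first `i` places, when the places in `a` are selected from the sequence `y`.
The value `0`, a lower bound of the values that occur, stands for the last selected value as long as
nothing has been selected. -/
noncomputable def stateAt (y : ℕ → ℝ) (a : Set ℕ) : ℕ → SelState
  | 0 => (true, 0)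
  | i + 1 => if i ∈ a then advance (stateAt y a i) (y i) else stateAt y a i

lemma stateAt_succ_of_mem {y : ℕ → ℝ} {a : Set ℕ} {i : ℕ} (h : i ∈ a) :
    stateAt y a (i + 1) = advance (stateAt y a i) (y i) := by
  simp [stateAt, h]

lemma stateAt_succ_of_notMem {y : ℕ → ℝ} {a : Set ℕ} {i : ℕ} (h : i ∉ a) :
    stateAt y a (i + 1) = stateAt y a i := by
  simp [stateAt, h]

lemma stateAt_snd_mem_Icc {y : ℕ → ℝ} (a : Set ℕ) (hy : ∀ i, y i ∈ Set.Icc (0 : ℝ) 1) (i : ℕ) :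
    (stateAt y a i).2 ∈ Set.Icc (0 : ℝ) 1 := by
  induction i with
  | zero => simp [stateAt]
  | succ i ih =>
    by_cases h : i ∈ a
    · rw [stateAt_succ_of_mem h]; exact hy i
    · rwa [stateAt_succ_of_notMem h]

lemma stateAt_rising {y : ℕ → ℝ} {a : Set ℕ} {i : ℕ} (h : (stateAt y a i).1 = true) :
    ((∀ j < i, j ∉ a) ∧ (stateAt y a i).2 = 0) ∨
      ∃ m < i, m ∈ a ∧ (stateAt y a i).2 = y m ∧ ∀ j < i, j ∈ a → j ≤ m := by
  induction i with
  | zero => left; simp [stateAt]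
  | succ i ih =>
    by_cases hi : i ∈ a
    · right
      refine ⟨i, by omega, hi, ?_, fun j hj _ => by omega⟩
      rw [stateAt_succ_of_mem hi]; rfl
    · rw [stateAt_succ_of_notMem hi] at h ⊢
      rcases ih h with ⟨h1, h2⟩ | ⟨m, hm, hma, h2, h3⟩
      · left
        refine ⟨fun j hj => ?_, h2⟩
        rcases Nat.lt_succ_iff_lt_or_eq.1 hj with hj | rfl
        exacts [h1 j hj, hi]
      · right
        refine ⟨m, by omega, hma, h2, fun j hj hja => ?_⟩
        rcases Nat.lt_succ_iff_lt_or_eq.1 hj with hj | rfl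
        exacts [h3 j hj hja, absurd hja hi]

/-- Once the selection has stopped rising it contains a strict descent. -/
lemma stateAt_falling {y : ℕ → ℝ} {a : Set ℕ} (hy : ∀ i, 0 ≤ y i) {i : ℕ}
    (h : (stateAt y a i).1 = false) :
    ∃ j ∈ a, ∃ k ∈ a, ∃ m ∈ a, j < k ∧ k ≤ m ∧ m < i ∧ y k < y j ∧ (stateAt y a i).2 = y m := by
  induction i with
  | zero => simp [stateAt] at h
  | succ i ih =>
    by_cases hi : i ∈ a
    · rw [stateAt_succ_of_mem hi] at h ⊢
      cases hs : (stateAt y a i).1 with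
      | false =>
        obtain ⟨j, hj, k, hk, m, hm, h1, h2, h3, h4, h5⟩ := ih hs
        exact ⟨j, hj, k, hk, i, hi, h1, by omega, by omega, h4, rfl⟩
      | true =>
        have hlt : y i < (stateAt y a i).2 := by simpa [advance, hs] using h
        rcases stateAt_rising hs with ⟨-, h2⟩ | ⟨m, hm, hma, h2, -⟩
        · linarith [hy i]
        · exact ⟨m, hma, i, hi, i, hi, hm, le_rfl, by omega, h2 ▸ hlt, rfl⟩
    · rw [stateAt_succ_of_notMem hi] at h ⊢
      obtain ⟨j, hj, k, hk, m, hm, h1, h2, h3, h4, h5⟩ := ih h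
      exact ⟨j, hj, k, hk, m, hm, h1, h2, by omega, h4, h5⟩

/-- In a unimodal selection each selected value may follow the preceding ones. -/
lemma canFollow_of_isUnimodalOn {n : ℕ} {y : ℕ → ℝ} (hy : ∀ i, 0 ≤ y i) {s : Finset (Fin n)}
    (hs : IsUnimodalOn (fun i : Fin n => y i) s) {i : ℕ}
    (hi : i ∈ ((↑) : Fin n → ℕ) '' (s : Set (Fin n))) :
    CanFollow (stateAt y (((↑) : Fin n → ℕ) '' (s : Set (Fin n))) i) (y i) := by
  set a := ((↑) : Fin n → ℕ) '' (s : Set (Fin n)) with ha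
  by_contra hcon
  simp only [CanFollow, not_or, Bool.not_eq_true, not_le] at hcon
  obtain ⟨_, ⟨j, hj, rfl⟩, _, ⟨k, hk, rfl⟩, _, ⟨m, hm, rfl⟩, h1, h2, h3, h4, h5⟩ :=
    stateAt_falling hy hcon.1
  obtain ⟨i, hi, rfl⟩ := hi
  obtain ⟨t, ht, hmono, hanti⟩ := hs ⟨i, hi⟩
  rw [h5] at hcon
  have htk : t < k := by
    by_contra hle
    push Not at hle
    exact absurd (hmono (a := j) (b := k) ⟨hj, by omega⟩ ⟨hk, hle⟩ (by omega)) (not_le.2 h4)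
  exact absurd (hanti (a := m) (b := i) ⟨hm, by omega⟩ ⟨hi, by omega⟩ (by omega))
    (not_le.2 hcon.2)

/-- A selection of values, each of which may follow the preceding ones and differs from the last of
them, is unimodal; so is the selection from any sequence `x` of which `y` is a monotone image. -/
lemma isUnimodalOn_of_canFollow {n : ℕ} {x y : ℕ → ℝ} (hy : ∀ i, 0 ≤ y i)
    (hxy : ∀ i j, y i < y j → x i < x j) {a : Set ℕ}
    (h : ∀ i ∈ a, CanFollow (stateAt y a i) (y i) ∧ y i ≠ (stateAt y a i).2)
    {s : Finset (Fin n)} (hs : ∀ i : Fin n, i ∈ s ↔ (i : ℕ) ∈ a) :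
    IsUnimodalOn (fun i : Fin n => x i) s := by
  have key : ∀ i : ℕ, ((stateAt y a i).1 = true → MonotoneOn x {j | j ∈ a ∧ j < i} ∧
        ∀ j ∈ a, j < i → y j ≤ (stateAt y a i).2) ∧
      ((stateAt y a i).1 = false → ∃ t ∈ a, t < i ∧ MonotoneOn x {j | j ∈ a ∧ j ≤ t} ∧
        AntitoneOn x {j | (j ∈ a ∧ j < i) ∧ t ≤ j} ∧
        ∀ j ∈ a, j < i → t ≤ j → (stateAt y a i).2 ≤ y j) := by
    intro i
    induction i with
    | zero => simp [stateAt, MonotoneOn]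
    | succ i ih =>
      by_cases hi : i ∈ a
      · rw [stateAt_succ_of_mem hi]
        obtain ⟨hf, hne⟩ := h i hi
        cases hs : (stateAt y a i).1 with
        | true =>
          obtain ⟨hm, hle⟩ := ih.1 hs
          refine ⟨fun hup => ?_, fun hdown => ?_⟩
          · have hlt : (stateAt y a i).2 < y i :=
              lt_of_le_of_ne (by simpa [advance, hs] using hup) hne.symm
            refine ⟨?_, ?_⟩
            · rintro j ⟨hj, hji⟩ k ⟨hk, hki⟩ hjk
              rcases Nat.lt_succ_iff_lt_or_eq.1 hki with hki | rfl
              · exact hm ⟨hj, by omega⟩ ⟨hk, hki⟩ hjk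
              · rcases Nat.lt_succ_iff_lt_or_eq.1 hji with hji | rfl
                · exact (hxy _ _ ((hle j hj hji).trans_lt hlt)).le
                · exact le_rfl
            · intro j hj hji
              rcases Nat.lt_succ_iff_lt_or_eq.1 hji with hji | rfl
              exacts [(hle j hj hji).trans hlt.le, le_rfl]
          · have hlt : y i < (stateAt y a i).2 := by simpa [advance, hs] using hdown
            rcases stateAt_rising hs with ⟨-, h2⟩ | ⟨m, hmi, hma, h2, hmax⟩
            · linarith [hy i]
            · refine ⟨m, hma, by omega, hm.mono fun j hj => ⟨hj.1, by have := hj.2; omega⟩, ?_, ?_⟩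
              · rintro j ⟨⟨hj, hji⟩, hmj⟩ k ⟨⟨hk, hki⟩, hmk⟩ hjk
                rcases Nat.lt_succ_iff_lt_or_eq.1 hki with hki | rfl
                · have h3 := hmax k hki hk
                  obtain rfl : j = k := by omega
                  exact le_rfl
                · rcases Nat.lt_succ_iff_lt_or_eq.1 hji with hji | rfl
                  · have h3 := hmax j hji hj
                    obtain rfl : j = m := by omega
                    exact (hxy _ _ (h2 ▸ hlt)).le
                  · exact le_rfl
              · intro j hj hji hmj
                rcases Nat.lt_succ_iff_lt_or_eq.1 hji with hji | rfl
                · have h3 := hmax j hji hj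
                  obtain rfl : j = m := by omega
                  exact (h2 ▸ hlt.le)
                · exact le_rfl
        | false =>
          refine ⟨fun hup => by simp [advance, hs] at hup, fun _ => ?_⟩
          obtain ⟨t, hta, hti, hmono, hanti, hle⟩ := ih.2 hs
          have hlt : y i < (stateAt y a i).2 :=
            lt_of_le_of_ne (by simpa [CanFollow, hs] using hf) hne
          refine ⟨t, hta, by omega, hmono, ?_, ?_⟩
          · rintro j ⟨⟨hj, hji⟩, htj⟩ k ⟨⟨hk, hki⟩, htk⟩ hjk
            rcases Nat.lt_succ_iff_lt_or_eq.1 hki with hki | rfl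
            · exact hanti ⟨⟨hj, by omega⟩, htj⟩ ⟨⟨hk, hki⟩, htk⟩ hjk
            · rcases Nat.lt_succ_iff_lt_or_eq.1 hji with hji | rfl
              · exact (hxy _ _ (hlt.trans_le (hle j hj hji htj))).le
              · exact le_rfl
          · intro j hj hji htj
            rcases Nat.lt_succ_iff_lt_or_eq.1 hji with hji | rfl
            exacts [hlt.le.trans (hle j hj hji htj), le_rfl]
      · rw [stateAt_succ_of_notMem hi]
        have hlt : ∀ j ∈ a, j < i + 1 → j < i := fun j hj hji =>
          lt_of_le_of_ne (by omega) fun hc => hi (hc ▸ hj)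
        refine ⟨fun hup => ?_, fun hdown => ?_⟩
        · obtain ⟨hm, hle⟩ := ih.1 hup
          exact ⟨hm.mono fun j hj => ⟨hj.1, hlt j hj.1 hj.2⟩,
            fun j hj hji => hle j hj (hlt j hj hji)⟩
        · obtain ⟨t, hta, hti, hmono, hanti, hle⟩ := ih.2 hdown
          exact ⟨t, hta, by omega, hmono,
            hanti.mono fun j hj => ⟨⟨hj.1.1, hlt j hj.1.1 hj.1.2⟩, hj.2⟩,
            fun j hj hji => hle j hj (hlt j hj hji)⟩
  intro hne
  cases hn : (stateAt y a n).1 with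
  | true =>
    obtain ⟨hm, -⟩ := (key n).1 hn
    refine ⟨s.max' hne, s.max'_mem hne, ?_, ?_⟩
    · rintro j ⟨hj, -⟩ k ⟨hk, -⟩ hjk
      exact hm ⟨(hs j).1 hj, j.2⟩ ⟨(hs k).1 hk, k.2⟩ hjk
    · rintro j ⟨hj, hj'⟩ k ⟨hk, -⟩ hjk
      have h1 := s.le_max' k hk
      obtain rfl : j = k := le_antisymm hjk (h1.trans hj')
      exact le_rfl
  | false =>
    obtain ⟨t, hta, htn, hmono, hanti, -⟩ := (key n).2 hn
    refine ⟨⟨t, htn⟩, (hs _).2 hta, ?_, ?_⟩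
    · rintro j ⟨hj, hjt⟩ k ⟨hk, hkt⟩ hjk
      exact hmono ⟨(hs j).1 hj, hjt⟩ ⟨(hs k).1 hk, hkt⟩ hjk
    · rintro j ⟨hj, hjt⟩ k ⟨hk, hkt⟩ hjk
      exact hanti ⟨⟨(hs j).1 hj, j.2⟩, hjt⟩ ⟨⟨(hs k).1 hk, k.2⟩, hkt⟩ hjk

/-! ### The budget of a selection -/

/-- The part of a budget of `2` that has been used: a selection of values in `[0, 1]` climbs by at
most `1` and then descends by at most `1`. After the turn the whole climb counts as used. -/
noncomputable def used (σ : SelState) : ℝ := if σ.1 then σ.2 else 2 - σ.2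

open Classical in
/-- The amount by which the cost of selecting `y` in the state `σ` falls short of the price `t`;
it is `0` if `y` may not be selected. -/
noncomputable def surplus (t : ℝ) (σ : SelState) (y : ℝ) : ℝ :=
  if CanFollow σ y then max (t - (used (advance σ y) - used σ)) 0 else 0

lemma surplus_nonneg (t : ℝ) (σ : SelState) (y : ℝ) : 0 ≤ surplus t σ y := by
  unfold surplus; split_ifs <;> simp

lemma surplus_le {t : ℝ} (ht : 0 ≤ t) {σ : SelState} {y : ℝ} (hσ : σ.2 ≤ 1) :
    surplus t σ y ≤ t := by
  unfold surplus
  split_ifs with h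
  · refine max_le ?_ ht
    obtain ⟨b, s⟩ := σ
    cases b
    · have : y ≤ s := by simpa [CanFollow] using h
      simp [used, advance]; linarith
    · simp only [used, advance] at *
      by_cases hsy : s ≤ y
      · simp [hsy]
      · simp [hsy]; linarith
  · exact ht

lemma used_le_two {σ : SelState} (hσ : σ.2 ∈ Set.Icc (0 : ℝ) 1) : used σ ≤ 2 := by
  unfold used; split_ifs <;> linarith [hσ.1, hσ.2]

/-- Pricing each selection at `t`, the total price is covered by the budget and the surpluses. -/
lemma mul_count_le {y : ℕ → ℝ} {a : Set ℕ} (t : ℝ)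
    (h : ∀ i ∈ a, CanFollow (stateAt y a i) (y i)) (i : ℕ) :
    t * ∑ j ∈ Finset.range i, a.indicator 1 j ≤
      used (stateAt y a i) + ∑ j ∈ Finset.range i, surplus t (stateAt y a j) (y j) := by
  induction i with
  | zero => simp [used, stateAt]
  | succ i ih =>
    rw [Finset.sum_range_succ, Finset.sum_range_succ, mul_add]
    by_cases hi : i ∈ a
    · rw [stateAt_succ_of_mem hi]
      have : t - (used (advance (stateAt y a i) (y i)) - used (stateAt y a i)) ≤
          surplus t (stateAt y a i) (y i) := by
        rw [surplus, if_pos (h i hi)]; exact le_max_left _ _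
      simp only [Set.indicator_of_mem hi, Pi.one_apply, mul_one]
      linarith
    · rw [stateAt_succ_of_notMem hi]
      simp only [Set.indicator_of_notMem hi, mul_zero, add_zero]
      linarith [surplus_nonneg t (stateAt y a i) (y i)]

/-- Up to the price `t`, the cost of selecting a uniform value is distributed at best as a uniform
one. Hence the mean surplus is at most that of a uniform cost. -/
lemma integral_surplus_le {t : ℝ} (ht : 0 ≤ t) {σ : SelState} (hσ : σ.2 ∈ Set.Icc (0 : ℝ) 1) :
    ∫ y in Set.Icc (0 : ℝ) 1, surplus t σ y ≤ t ^ 2 / 2 := by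
  obtain ⟨b, s⟩ := σ
  obtain ⟨h0, h1⟩ := hσ
  simp only at h0 h1
  set f : ℝ → ℝ := fun x => max (t - x) 0 with hf
  have hfc : Continuous f := by fun_prop
  have hf0 : ∀ x, 0 ≤ f x := fun x => le_max_right _ _
  have hfi : ∀ a b, IntervalIntegrable f volume a b := fun a b => hfc.intervalIntegrable a b
  have hbase : ∀ u, 0 ≤ u → ∫ x in (0 : ℝ)..u, f x ≤ t ^ 2 / 2 := by
    intro u hu
    have hA : ∫ x in (0 : ℝ)..t, f x = t ^ 2 / 2 := by
      rw [intervalIntegral.integral_congr (g := fun x => t - x)]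
      · rw [intervalIntegral.integral_sub (by simp) (by simp)]
        simp; ring
      · intro x hx
        rw [Set.uIcc_of_le ht] at hx
        exact max_eq_left (by linarith [hx.2])
    have hB : ∀ u, t ≤ u → ∫ x in t..u, f x = 0 := by
      intro u hu
      rw [intervalIntegral.integral_congr (g := fun _ => 0)]
      · simp
      · intro x hx
        rw [Set.uIcc_of_le hu] at hx
        exact max_eq_right (by linarith [hx.1])
    have hC : ∫ x in u..(max t u), f x ≥ 0 :=
      intervalIntegral.integral_nonneg (le_max_right _ _) fun x _ => hf0 x
    have h2 := intervalIntegral.integral_add_adjacent_intervals (hfi 0 u) (hfi u (max t u))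
    have h3 := intervalIntegral.integral_add_adjacent_intervals (hfi 0 t) (hfi t (max t u))
    rw [hB _ (le_max_left _ _), hA] at h3
    linarith
  rw [integral_Icc_eq_integral_Ioc, ← intervalIntegral.integral_of_le zero_le_one]
  cases b with
  | false =>
    have e1 : ∀ y ∈ Set.uIoc (0 : ℝ) s, surplus t (false, s) y = f (s - y) := by
      intro y hy
      rw [Set.uIoc_of_le h0] at hy
      simp [surplus, CanFollow, used, advance, hy.2, hf]
    have e2 : ∀ y ∈ Set.uIoc s 1, surplus t (false, s) y = 0 := by
      intro y hy
      rw [Set.uIoc_of_le h1] at hy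
      simp [surplus, CanFollow, hy.1]
    rw [← intervalIntegral.integral_add_adjacent_intervals (b := s)]
    · rw [intervalIntegral.integral_congr_ae (ae_of_all _ e1),
        intervalIntegral.integral_congr_ae (ae_of_all _ e2)]
      rw [intervalIntegral.integral_comp_sub_left f s]
      simpa using hbase s h0
    · exact (intervalIntegrable_congr e1).2
        ((hfc.comp (by fun_prop : Continuous fun y => s - y)).intervalIntegrable _ _)
    · exact (intervalIntegrable_congr e2).2 (by simp)
  | true =>
    -- The costs of the values above `s` fill `[0, 1 - s]`, those of the values below `s` fill
    -- `[2 - 2 s, 2 - s]`, and these intervals do not overlap.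
    have e1 : ∀ y ∈ Set.Ioo (0 : ℝ) s, surplus t (true, s) y = f ((2 - s) - y) := by
      intro y hy
      have : ¬ s ≤ y := not_le.2 hy.2
      simp [surplus, CanFollow, used, advance, this, hf]
      congr 2; ring
    have e2 : ∀ y ∈ Set.uIoc s 1, surplus t (true, s) y = f (y - s) := by
      intro y hy
      rw [Set.uIoc_of_le h1] at hy
      simp [surplus, CanFollow, used, advance, hy.1.le, hf]
    have e1' : ∀ᵐ y ∂volume, y ∈ Set.uIoc (0 : ℝ) s → surplus t (true, s) y = f ((2 - s) - y) := by
      filter_upwards [Measure.ae_ne volume s] with y hys hy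
      rw [Set.uIoc_of_le h0] at hy
      exact e1 y ⟨hy.1, lt_of_le_of_ne hy.2 hys⟩
    rw [← intervalIntegral.integral_add_adjacent_intervals (b := s)]
    · rw [intervalIntegral.integral_congr_ae e1',
        intervalIntegral.integral_congr_ae (ae_of_all _ e2)]
      rw [intervalIntegral.integral_comp_sub_left f (2 - s),
        intervalIntegral.integral_comp_sub_right f s]
      have h4 := intervalIntegral.integral_add_adjacent_intervals (hfi 0 (1 - s))
        (hfi (1 - s) (2 - s - s))
      have h5 := intervalIntegral.integral_add_adjacent_intervals (hfi 0 (2 - s - s))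
        (hfi (2 - s - s) (2 - s))
      have h6 : ∫ x in (1 - s)..(2 - s - s), f x ≥ 0 :=
        intervalIntegral.integral_nonneg (by linarith) fun x _ => hf0 x
      have := hbase (2 - s) (by linarith)
      simp only [sub_self, sub_zero]
      linarith
    · refine IntervalIntegrable.congr_ae (f := fun y => f ((2 - s) - y)) ?_ ?_
      · exact ((hfc.comp (by fun_prop : Continuous fun y => 2 - s - y)).intervalIntegrable _ _)
      · rw [EventuallyEq, ae_restrict_iff' measurableSet_uIoc]
        filter_upwards [e1'] with y hy h using (hy h).symm
    · exact (intervalIntegrable_congr e2).2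
        ((hfc.comp (by fun_prop : Continuous fun y => y - s)).intervalIntegrable _ _)

lemma measurable_advance : Measurable fun p : SelState × ℝ => advance p.1 p.2 := by
  have h : MeasurableSet {p : SelState × ℝ | p.1.2 ≤ p.2} :=
    measurableSet_le (by fun_prop) (by fun_prop)
  have h2 : Measurable fun p : SelState × ℝ => decide (p.1.2 ≤ p.2) := measurable_to_bool (by
    convert h using 1; ext; simp)
  have h3 : Measurable fun q : Bool × Bool => (q.1 && q.2) := measurable_of_finite _
  exact (h3.comp ((measurable_fst.comp measurable_fst).prodMk h2)).prodMk measurable_snd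

lemma measurableSet_canFollow : MeasurableSet {p : SelState × ℝ | CanFollow p.1 p.2} := by
  refine MeasurableSet.union (s₁ := {p : SelState × ℝ | p.1.1 = true})
    (s₂ := {p : SelState × ℝ | p.2 ≤ p.1.2}) ?_ ?_
  · exact (measurable_fst.comp measurable_fst) (measurableSet_singleton true)
  · exact measurableSet_le (by fun_prop) (by fun_prop)

lemma measurable_used : Measurable used := by
  refine Measurable.ite ?_ measurable_snd (measurable_const.sub measurable_snd)
  exact measurable_fst (measurableSet_singleton true)

lemma measurable_surplus (t : ℝ) : Measurable fun p : SelState × ℝ => surplus t p.1 p.2 := by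
  refine Measurable.ite measurableSet_canFollow ?_ measurable_const
  exact (measurable_const.sub ((measurable_used.comp measurable_advance).sub
    (measurable_used.comp measurable_fst))).max measurable_const

/-! ### The value of a state -/

open Classical in
/-- The larger of the values of passing over `y` and of selecting it, in the state `σ`, if `v` is
the value of a state afterwards. If `y` may not be selected, the second one is replaced by
`0`, which does not count because values are nonnegative. -/
noncomputable def bestGain (v : SelState → ℝ) (σ : SelState) (y : ℝ) : ℝ :=
  max (v σ) (if CanFollow σ y then 1 + v (advance σ y) else 0)

/-- The largest expected number of further selections when `k` uniform values are still to come: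
the solution of the Bellman equation. -/
noncomputable def value : ℕ → SelState → ℝ
  | 0 => fun _ => 0
  | k + 1 => fun σ => ∫ y in Set.Icc (0 : ℝ) 1, bestGain (value k) σ y

lemma measurable_bestGain {v : SelState → ℝ} (hv : Measurable v) :
    Measurable fun p : SelState × ℝ => bestGain v p.1 p.2 := by
  refine (hv.comp measurable_fst).max (Measurable.ite measurableSet_canFollow ?_ measurable_const)
  exact measurable_const.add (hv.comp measurable_advance)

lemma measurable_value (k : ℕ) : Measurable (value k) := by
  induction k with
  | zero => exact measurable_const
  | succ k ih =>
    exact ((measurable_bestGain ih).stronglyMeasurable.integral_prod_right').measurable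

lemma bestGain_mem_Icc {v : SelState → ℝ} {c : ℝ} (hv : ∀ σ, v σ ∈ Set.Icc 0 c)
    (σ : SelState) (y : ℝ) : bestGain v σ y ∈ Set.Icc 0 (c + 1) := by
  unfold bestGain
  refine ⟨le_max_of_le_left (hv σ).1, max_le (by linarith [(hv σ).2]) ?_⟩
  split_ifs
  · linarith [(hv (advance σ y)).2]
  · linarith [(hv σ).1, (hv σ).2]

lemma integrableOn_of_mem_Icc {f : ℝ → ℝ} (hf : Measurable f) {c : ℝ}
    (h : ∀ y, f y ∈ Set.Icc 0 c) : IntegrableOn f (Set.Icc 0 1) := by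
  refine Integrable.of_bound (C := c) hf.aestronglyMeasurable (ae_of_all _ fun y => ?_)
  rw [Real.norm_of_nonneg (h y).1]; exact (h y).2

lemma value_mem_Icc (k : ℕ) (σ : SelState) : value k σ ∈ Set.Icc (0 : ℝ) k := by
  induction k generalizing σ with
  | zero => simp [value]
  | succ k ih =>
    have h := bestGain_mem_Icc ih
    refine ⟨integral_nonneg fun y => (h σ y).1, ?_⟩
    have h2 : ∫ y in Set.Icc (0 : ℝ) 1, bestGain (value k) σ y ≤
        ∫ y in Set.Icc (0 : ℝ) 1, ((k : ℝ) + 1) := by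
      refine integral_mono (integrableOn_of_mem_Icc
        ((measurable_bestGain (measurable_value k)).comp measurable_prodMk_left) (h σ)) (by simp)
        fun y => (h σ y).2
    simpa [value] using h2

lemma integrableOn_bestGain (k : ℕ) (σ : SelState) :
    IntegrableOn (bestGain (value k) σ) (Set.Icc 0 1) :=
  integrableOn_of_mem_Icc ((measurable_bestGain (measurable_value k)).comp measurable_prodMk_left)
    (bestGain_mem_Icc (value_mem_Icc k) σ)

lemma value_le_value_succ (k : ℕ) (σ : SelState) : value k σ ≤ value (k + 1) σ := by
  have h2 : ∫ y in Set.Icc (0 : ℝ) 1, value k σ ≤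
      ∫ y in Set.Icc (0 : ℝ) 1, bestGain (value k) σ y :=
    integral_mono (by simp) (integrableOn_bestGain k σ) fun y => le_max_left _ _
  simpa [value] using h2

/-- While the selection rises it may still be turned into any falling one. -/
lemma value_falling_le_rising (k : ℕ) (s s' : ℝ) : value k (false, s') ≤ value k (true, s) := by
  induction k generalizing s s' with
  | zero => simp [value]
  | succ k ih =>
    refine integral_mono (integrableOn_bestGain k _) (integrableOn_bestGain k _) fun y => ?_
    refine max_le_max (ih s s') ?_
    have hy : value k (false, y) ≤ value k (advance (true, s) y) := by
      unfold advance
      by_cases h : s ≤ y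
      · simpa [h] using ih y y
      · simp [h]
    have hnn := (value_mem_Icc k (advance (true, s) y)).1
    by_cases h : y ≤ s'
    · simpa [CanFollow, h, advance] using hy
    · simp [CanFollow, h]; linarith

/-- The Bellman equation gives a lower bound for every plan, here for that of selecting
exactly the values in `[p, q]`. -/
lemma value_succ_ge {k : ℕ} {σ : SelState} {p q : ℝ} (hp : 0 ≤ p) (hpq : p ≤ q) (hq : q ≤ 1)
    {g : ℝ → ℝ} (hg : Continuous g)
    (h : ∀ y ∈ Set.Icc p q, CanFollow σ y ∧ g y ≤ 1 + value k (advance σ y)) :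
    (1 - (q - p)) * value k σ + ∫ y in p..q, g y ≤ value (k + 1) σ := by
  have hint := integrableOn_bestGain k σ
  have hi : ∀ a b, 0 ≤ a → a ≤ b → b ≤ 1 →
      IntervalIntegrable (bestGain (value k) σ) volume a b := fun a b ha hab hb =>
    (intervalIntegrable_iff_integrableOn_Icc_of_le hab).2
      (hint.mono_set (Set.Icc_subset_Icc ha hb))
  have e : value (k + 1) σ = ∫ y in (0 : ℝ)..1, bestGain (value k) σ y := by
    rw [intervalIntegral.integral_of_le zero_le_one, ← integral_Icc_eq_integral_Ioc]; rfl
  have hc : ∀ a b, 0 ≤ a → a ≤ b → b ≤ 1 →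
      (b - a) * value k σ ≤ ∫ y in a..b, bestGain (value k) σ y := by
    intro a b ha hab hb
    have := intervalIntegral.integral_mono_on hab (f := fun _ => value k σ) (by simp)
      (hi a b ha hab hb) fun y _ => le_max_left _ _
    simpa using this
  have hm : ∫ y in p..q, g y ≤ ∫ y in p..q, bestGain (value k) σ y := by
    refine intervalIntegral.integral_mono_on hpq (hg.intervalIntegrable _ _) (hi p q hp hpq hq)
      fun y hy => ?_
    refine le_max_of_le_right ?_
    rw [if_pos (h y hy).1]; exact (h y hy).2
  rw [e, ← intervalIntegral.integral_add_adjacent_intervals (hi 0 p le_rfl hp (hpq.trans hq))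
    (hi p 1 hp (hpq.trans hq) le_rfl), ← intervalIntegral.integral_add_adjacent_intervals
    (hi p q hp hpq hq) (hi q 1 (hp.trans hpq) hq le_rfl)]
  nlinarith [hc 0 p le_rfl hp (hpq.trans hq), hc q 1 (hp.trans hpq) hq le_rfl]

/-! ### Growth of the value -/

/-- A family `w` that satisfies the Bellman inequality of monotone selection grows like `√(2kr)`,
where `r` is the room that is left. The inequality is only needed for the plans of selecting the
values within a distance `δ` of the last one, with a linear minorant of the gain on the window. -/
lemma exists_sqrt_le_of_bellman {a : ℝ} (ha : 0 < a) (ha2 : a ^ 2 < 2) :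
    ∃ C : ℝ, ∀ w : ℕ → ℝ → ℝ, (∀ k r, 0 ≤ w k r) →
      (∀ (k : ℕ) (r δ α β : ℝ), 0 ≤ δ → δ ≤ r → r ≤ 1 →
        (∀ x ∈ Set.Icc 0 δ, α - β * x ≤ 1 + w k (r - x)) →
        (1 - δ) * w k r + (α * δ - β * δ ^ 2 / 2) ≤ w (k + 1) r) →
      ∀ (k : ℕ) (r : ℝ), 0 ≤ r → r ≤ 1 → a * √(k * r) - C ≤ w k r := by
  -- The best window is `δ = (2 / a) √(r / k)`; `c > 1` is the slack that `a < √2` leaves for the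
  -- linearization of the square root, which is good enough once `√(k r) ≥ L`.
  set c : ℝ := 2 - a ^ 2 / 2 with hc
  have hc1 : 1 < c := by linarith
  have hc0 : 0 < c := by linarith
  have hcc : 0 < 1 - 1 / c ^ 2 := by
    have : 1 / c ^ 2 < 1 := by rw [div_lt_one (by positivity)]; nlinarith
    linarith
  set L : ℝ := 2 / a / (1 - 1 / c ^ 2) with hL
  have hL0 : 0 < L := by positivity
  refine ⟨a * √(L ^ 2 + 1), fun w hw hstep k => ?_⟩
  set C := a * √(L ^ 2 + 1) with hC
  have hC0 : 0 ≤ C := by positivity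
  induction k with
  | zero => intro r _ _; simp; linarith [hw 0 r]
  | succ k ih =>
    intro r hr0 hr1
    rcases lt_or_ge √(k * r) L with hlt | hge
    · have h1 : (k : ℝ) * r ≤ L ^ 2 := ((Real.sqrt_lt' hL0).1 hlt).le
      have h2 : √(((k + 1 : ℕ) : ℝ) * r) ≤ √(L ^ 2 + 1) :=
        Real.sqrt_le_sqrt (by push_cast; nlinarith)
      have h3 := mul_le_mul_of_nonneg_left h2 ha.le
      linarith [hw (k + 1) r]
    · set q := √(k * r) with hq
      have hq0 : 0 < q := hL0.trans_le hge
      have hqq : q ^ 2 = k * r := Real.sq_sqrt (by positivity)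
      set δ := 2 / a * r / q with hδ
      have hδ0 : 0 ≤ δ := by positivity
      have hδr : δ ≤ (1 - 1 / c ^ 2) * r := by
        have h1 : 2 / a ≤ (1 - 1 / c ^ 2) * q := by
          rw [hL, div_le_iff₀ hcc] at hge; linarith
        rw [hδ, div_le_iff₀ hq0]; nlinarith
      have hδr' : δ ≤ r := hδr.trans (mul_le_of_le_one_left hr0 (by
        have : 0 < 1 / c ^ 2 := by positivity
        linarith))
      have hmin : ∀ x ∈ Set.Icc 0 δ,
          (1 + a * q - C) - (a * k * c / (2 * q)) * x ≤ 1 + w k (r - x) := by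
        rintro x ⟨hx0, hxδ⟩
        have h1 := ih (r - x) (by linarith) (by linarith)
        set u := √(k * (r - x)) with hu
        have huu : u ^ 2 = q ^ 2 - k * x := by
          rw [hu, Real.sq_sqrt (mul_nonneg (by positivity) (by linarith)), hqq]; ring
        have huq : q ≤ c * u := by
          have h2 : q ^ 2 ≤ (c * u) ^ 2 := by
            have h3 : c ^ 2 * δ ≤ (c ^ 2 - 1) * r := by
              have h4 := mul_le_mul_of_nonneg_left hδr (sq_nonneg c)
              have h5 : c ^ 2 * ((1 - 1 / c ^ 2) * r) = (c ^ 2 - 1) * r := by field_simp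
              linarith
            have h6 : r ≤ c ^ 2 * (r - x) := by nlinarith [sq_nonneg c]
            have h7 := mul_le_mul_of_nonneg_left h6 (Nat.cast_nonneg (α := ℝ) k)
            rw [mul_pow, huu, hqq]; linarith
          exact le_of_sq_le_sq h2 (by positivity)
        have h8 : q - k * c / (2 * q) * x ≤ u := by
          have h9 : 0 ≤ q - u := by
            have : u ≤ q := Real.sqrt_le_sqrt (by gcongr; linarith)
            linarith
          have h10 : 2 * q ≤ c * (q + u) := by nlinarith
          have h11 : (q - u) * (2 * q) ≤ k * c * x := by
            have : k * x = (q - u) * (q + u) := by linarith [huu]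
            nlinarith [mul_le_mul_of_nonneg_left h10 h9]
          have h12 : k * c / (2 * q) * x = k * c * x / (2 * q) := by ring
          rw [h12, sub_le_comm, le_div_iff₀ (by positivity)]
          exact h11
        have h13 := mul_le_mul_of_nonneg_left h8 ha.le
        have h14 : a * (q - k * c / (2 * q) * x) = a * q - a * k * c / (2 * q) * x := by ring
        linarith
      have h1 := hstep k r δ _ _ hδ0 hδr' hr1 hmin
      have h2 := ih r hr0 hr1
      have h3 : (1 - δ) * (a * q - C) ≤ (1 - δ) * w k r :=
        mul_le_mul_of_nonneg_left h2 (by linarith)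
      have h4 : δ - a * k * c / (2 * q) * δ ^ 2 / 2 = a * (r / (2 * q)) := by
        have h5 : (k : ℝ) * r / q ^ 2 = 1 := by rw [hqq]; exact div_self (by rw [← hqq]; positivity)
        have h6 : a * k * c / (2 * q) * δ ^ 2 / 2 = (k * r / q ^ 2) * (c * r / (a * q)) := by
          rw [hδ]; field_simp
        rw [h6, h5, hδ, hc]; field_simp; ring
      have h7 : √(((k + 1 : ℕ) : ℝ) * r) ≤ q + r / (2 * q) := by
        refine Real.sqrt_le_iff.2 ⟨by positivity, ?_⟩
        have : (q + r / (2 * q)) ^ 2 = q ^ 2 + r + (r / (2 * q)) ^ 2 := by field_simp; ring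
        rw [this, hqq]; push_cast; nlinarith [sq_nonneg (r / (2 * q))]
      have h8 := mul_le_mul_of_nonneg_left h7 ha.le
      nlinarith

lemma integral_linear (α β δ : ℝ) :
    ∫ x in (0 : ℝ)..δ, (α - β * x) = α * δ - β * δ ^ 2 / 2 := by
  rw [intervalIntegral.integral_sub (by simp)
    ((by fun_prop : Continuous fun x => β * x).intervalIntegrable _ _),
    intervalIntegral.integral_const_mul]
  simp; ring

lemma value_mono_left {m k : ℕ} (h : m ≤ k) (σ : SelState) : value m σ ≤ value k σ :=
  monotone_nat_of_le_succ (f := fun k => value k σ) (fun k => value_le_value_succ k σ) h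

/-- Rising through the first `m` values and falling through the last `m` ones gives nearly
`√(2m)` selections each time. -/
lemma exists_le_value {a : ℝ} (ha : 0 < a) (ha2 : a ^ 2 < 2) :
    ∃ C : ℝ, ∀ m : ℕ, 2 * (a * √m - C) ≤ value (m + m) (true, 0) := by
  obtain ⟨C, hC⟩ := exists_sqrt_le_of_bellman ha ha2
  refine ⟨C, fun m => ?_⟩
  have hfall : a * √(m * 1) - C ≤ value m (false, 1) := by
    refine hC (fun k r => value k (false, r)) (fun k r => (value_mem_Icc k _).1) ?_ m 1
      zero_le_one le_rfl
    intro k r δ α β hδ hδr hr h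
    have h1 := value_succ_ge (k := k) (σ := (false, r)) (p := r - δ) (q := r) (by linarith)
      (by linarith) hr (g := fun y => α - β * (r - y)) (by fun_prop) (fun y hy => ?_)
    · have e : ∫ y in (r - δ)..r, (α - β * (r - y)) = α * δ - β * δ ^ 2 / 2 := by
        rw [intervalIntegral.integral_comp_sub_left (fun x => α - β * x) r, sub_self,
          sub_sub_cancel, integral_linear]
      rw [e] at h1
      simpa using h1
    · refine ⟨Or.inr hy.2, ?_⟩
      simpa [advance] using h (r - y) ⟨by linarith [hy.2], by linarith [hy.1]⟩
  have hrise : a * √(m * 1) - C ≤ value (m + m) (true, 1 - 1) - value m (false, 1) := by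
    refine hC (fun k r => value (m + k) (true, 1 - r) - value m (false, 1)) (fun k r => ?_) ?_ m 1
      zero_le_one le_rfl
    · have h1 := value_mono_left (Nat.le_add_right m k) (true, 1 - r)
      have h2 := value_falling_le_rising m (1 - r) 1
      linarith
    · intro k r δ α β hδ hδr hr h
      have h1 := value_succ_ge (k := m + k) (σ := (true, 1 - r)) (p := 1 - r) (q := 1 - r + δ)
        (by linarith) (by linarith) (by linarith)
        (g := fun y => (value m (false, 1) + α) - β * (y - (1 - r))) (by fun_prop)
        (fun y hy => ?_)
      · have e : ∫ y in (1 - r)..(1 - r + δ), ((value m (false, 1) + α) - β * (y - (1 - r))) =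
            (value m (false, 1) + α) * δ - β * δ ^ 2 / 2 := by
          rw [intervalIntegral.integral_comp_sub_right
              (fun x => (value m (false, 1) + α) - β * x) (1 - r),
            sub_self, add_sub_cancel_left, integral_linear]
        rw [e, add_sub_cancel_left] at h1
        have h2 : m + (k + 1) = m + k + 1 := rfl
        simp only [h2]
        linarith
      · refine ⟨Or.inl rfl, ?_⟩
        have h2 := h (y - (1 - r)) ⟨by linarith [hy.1], by linarith [hy.2]⟩
        have h3 : 1 - (r - (y - (1 - r))) = y := by ring
        rw [h3] at h2
        have h4 : advance (true, 1 - r) y = (true, y) := by simp [advance]; linarith [hy.1]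
        rw [h4]; linarith
  rw [mul_one] at hfall hrise
  rw [sub_self] at hrise
  linarith

/-- The value of the initial state is at least `(2 - ε) √n` eventually. -/
lemma eventually_le_value {ε : ℝ} (hε : 0 < ε) :
    ∀ᶠ n : ℕ in atTop, (2 - ε) * √n ≤ value n (true, 0) := by
  rcases le_or_gt 2 ε with h2 | h2
  · refine Eventually.of_forall fun n => le_trans ?_ (value_mem_Icc n _).1
    exact mul_nonpos_of_nonpos_of_nonneg (by linarith) (Real.sqrt_nonneg _)
  set a : ℝ := √2 * (1 - ε / 4) with ha
  have hs : √2 ^ 2 = 2 := Real.sq_sqrt (by norm_num)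
  have ha0 : 0 < a := mul_pos (by positivity) (by linarith)
  have ha2 : a ^ 2 < 2 := by rw [ha, mul_pow, hs]; nlinarith
  obtain ⟨C, hC⟩ := exists_le_value ha0 ha2
  have hlim : Tendsto (fun n : ℕ => √(n : ℝ)) atTop atTop :=
    Real.tendsto_sqrt_atTop.comp tendsto_natCast_atTop_atTop
  filter_upwards [hlim.eventually_ge_atTop (2 * (2 + 2 * |C|) / ε)] with n hn
  rw [div_le_iff₀ hε] at hn
  have h1 := (hC (n / 2)).trans (value_mono_left (by omega : n / 2 + n / 2 ≤ n) (true, 0))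
  have h3 : √(n : ℝ) ≤ √2 * √((n / 2 : ℕ) : ℝ) + 1 := by
    have h4 : (n : ℝ) ≤ 2 * ((n / 2 : ℕ) : ℝ) + 1 := by
      exact_mod_cast (by omega : n ≤ 2 * (n / 2) + 1)
    refine Real.sqrt_le_iff.2 ⟨by positivity, ?_⟩
    have h5 : (√2 * √((n / 2 : ℕ) : ℝ)) ^ 2 = 2 * ((n / 2 : ℕ) : ℝ) := by
      rw [mul_pow, hs, Real.sq_sqrt (by positivity)]
    have : 0 ≤ √2 * √((n / 2 : ℕ) : ℝ) := by positivity
    nlinarith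
  have h6 : 2 * (a * √((n / 2 : ℕ) : ℝ)) ≥ 2 * (1 - ε / 4) * (√n - 1) := by
    have : 2 * (a * √((n / 2 : ℕ) : ℝ)) = 2 * (1 - ε / 4) * (√2 * √((n / 2 : ℕ) : ℝ)) := by
      rw [ha]; ring
    rw [this]
    exact mul_le_mul_of_nonneg_left (by linarith) (by linarith)
  nlinarith [le_abs_self C]

/-! ### Selection from a stream of uniform values -/

/-- The values `Y 0, Y 1, …` lie in `[0, 1]`, and `Y i` is uniform and independent of the past
`𝓕 i`, which knows the values before the `i`-th one. -/
structure IsUniformStream {Ω : Type*} [mΩ : MeasurableSpace Ω] (P : Measure Ω)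
    (𝓕 : ℕ → MeasurableSpace Ω) (Y : ℕ → Ω → ℝ) : Prop where
  mono : Monotone 𝓕
  le : ∀ i, 𝓕 i ≤ mΩ
  measurable : ∀ i, Measurable[𝓕 (i + 1)] (Y i)
  indep : ∀ i, Indep (𝓕 i) (MeasurableSpace.comap (Y i) inferInstance) P
  law : ∀ i, P.map (Y i) = volume.restrict (Set.Icc 0 1)
  mem_Icc : ∀ i ω, Y i ω ∈ Set.Icc (0 : ℝ) 1

/-- The number of selections among the first `n` places. -/
noncomputable def countBefore (n : ℕ) (a : Set ℕ) : ℝ := ∑ j ∈ Finset.range n, a.indicator 1 j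

lemma countBefore_mem_Icc (n : ℕ) (a : Set ℕ) : countBefore n a ∈ Set.Icc (0 : ℝ) n := by
  classical
  constructor
  · exact Finset.sum_nonneg fun j _ => Set.indicator_nonneg (by simp) j
  · calc countBefore n a ≤ ∑ j ∈ Finset.range n, (1 : ℝ) :=
          Finset.sum_le_sum fun j _ => Set.indicator_le_self' (by simp) j
      _ = n := by simp

namespace IsUniformStream

variable {Ω : Type*} [mΩ : MeasurableSpace Ω] {P : Measure Ω}
  {𝓕 : ℕ → MeasurableSpace Ω} {Y : ℕ → Ω → ℝ}

lemma measurable_stateAt (h : IsUniformStream P 𝓕 Y) {a : Ω → Set ℕ}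
    (ha : ∀ i, MeasurableSet[𝓕 (i + 1)] {ω | i ∈ a ω}) (i : ℕ) :
    Measurable[𝓕 i] fun ω => stateAt (fun j => Y j ω) (a ω) i := by
  induction i with
  | zero => exact measurable_const
  | succ i ih =>
    have ih' := ih.mono (h.mono (Nat.le_succ i)) le_rfl
    exact Measurable.ite (ha i) (measurable_advance.comp (ih'.prodMk (h.measurable i))) ih'

lemma measurable_countBefore (h : IsUniformStream P 𝓕 Y) {a : Ω → Set ℕ}
    (ha : ∀ i, MeasurableSet[𝓕 (i + 1)] {ω | i ∈ a ω}) (n : ℕ) :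
    Measurable fun ω => countBefore n (a ω) := by
  refine Finset.measurable_sum _ fun j _ => ?_
  have : (fun ω => (a ω).indicator (1 : ℕ → ℝ) j) = {ω | j ∈ a ω}.indicator 1 := by
    ext ω; by_cases hj : j ∈ a ω <;> simp [hj]
  rw [this]
  exact measurable_one.indicator (h.le _ _ (ha j))

lemma stateAt_mem_Icc (h : IsUniformStream P 𝓕 Y) (a : Ω → Set ℕ) (i : ℕ) (ω : Ω) :
    (stateAt (fun j => Y j ω) (a ω) i).2 ∈ Set.Icc (0 : ℝ) 1 :=
  stateAt_snd_mem_Icc _ (fun j => h.mem_Icc j ω) i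

variable [IsProbabilityMeasure P]

/-- A fresh value may be integrated out with the past held fixed. -/
lemma integral_comp (h : IsUniformStream P 𝓕 Y) {E : Type*} [MeasurableSpace E] {i : ℕ}
    {Z : Ω → E} (hZ : Measurable[𝓕 i] Z) {Φ : E × ℝ → ℝ} (hΦ : Measurable Φ)
    (hint : Integrable (fun ω => Φ (Z ω, Y i ω)) P) :
    ∫ ω, Φ (Z ω, Y i ω) ∂P = ∫ ω, (∫ y in Set.Icc (0 : ℝ) 1, Φ (Z ω, y)) ∂P := by
  have hZ' : Measurable Z := hZ.mono (h.le i) le_rfl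
  have hY : Measurable (Y i) := (h.measurable i).mono (h.le _) le_rfl
  have hind : IndepFun Z (Y i) P :=
    (IndepFun_iff_Indep _ _ _).2 (indep_of_indep_of_le_left (h.indep i) hZ.comap_le)
  have hmap := (indepFun_iff_map_prod_eq_prod_map_map hZ'.aemeasurable hY.aemeasurable).1 hind
  rw [h.law i] at hmap
  have hm : Measurable fun ω => (Z ω, Y i ω) := hZ'.prodMk hY
  have hint' : Integrable Φ ((P.map Z).prod (volume.restrict (Set.Icc 0 1))) := by
    rw [← hmap]
    exact (integrable_map_measure hΦ.aestronglyMeasurable hm.aemeasurable).2 hint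
  have : IsProbabilityMeasure (P.map Z) := Measure.isProbabilityMeasure_map hZ'.aemeasurable
  rw [← integral_map (φ := fun ω => (Z ω, Y i ω)) hm.aemeasurable hΦ.aestronglyMeasurable, hmap,
    integral_prod _ hint', integral_map hZ'.aemeasurable]
  exact hΦ.stronglyMeasurable.integral_prod_right'.aestronglyMeasurable

lemma integral_mul_surplus_le (h : IsUniformStream P 𝓕 Y) {a : Ω → Set ℕ}
    (ha : ∀ i, MeasurableSet[𝓕 (i + 1)] {ω | i ∈ a ω}) {t : ℝ} (ht : 0 ≤ t) {i : ℕ} {W : Ω → ℝ}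
    (hW : Measurable[𝓕 i] W) {c : ℝ} (hWc : ∀ ω, W ω ∈ Set.Icc 0 c) :
    ∫ ω, W ω * surplus t (stateAt (fun j => Y j ω) (a ω) i) (Y i ω) ∂P ≤
      (∫ ω, W ω ∂P) * (t ^ 2 / 2) := by
  have hσ := h.measurable_stateAt ha i
  have hΦ : Measurable fun p : (ℝ × SelState) × ℝ => p.1.1 * surplus t p.1.2 p.2 :=
    (measurable_fst.comp measurable_fst).mul
      ((measurable_surplus t).comp ((measurable_snd.comp measurable_fst).prodMk measurable_snd))
  have hm : Measurable fun ω => ((W ω, stateAt (fun j => Y j ω) (a ω) i), Y i ω) :=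
    ((hW.prodMk hσ).mono (h.le i) le_rfl).prodMk ((h.measurable i).mono (h.le _) le_rfl)
  have hint : Integrable
      (fun ω => W ω * surplus t (stateAt (fun j => Y j ω) (a ω) i) (Y i ω)) P := by
    refine Integrable.of_bound (C := c * t) (hΦ.comp hm).aestronglyMeasurable
      (ae_of_all _ fun ω => ?_)
    rw [Real.norm_of_nonneg (mul_nonneg (hWc ω).1 (surplus_nonneg _ _ _))]
    exact mul_le_mul (hWc ω).2 (surplus_le ht (h.stateAt_mem_Icc a i ω).2) (surplus_nonneg _ _ _)
      ((hWc ω).1.trans (hWc ω).2)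
  have hWi : Integrable W P := by
    refine Integrable.of_bound (C := c) (hW.mono (h.le i) le_rfl).aestronglyMeasurable
      (ae_of_all _ fun ω => ?_)
    rw [Real.norm_of_nonneg (hWc ω).1]; exact (hWc ω).2
  have e := h.integral_comp (hW.prodMk hσ) hΦ hint
  simp only at e
  rw [e, ← integral_mul_const]
  refine integral_mono_of_nonneg (ae_of_all _ fun ω => ?_) (hWi.mul_const _)
    (ae_of_all _ fun ω => ?_)
  · exact integral_nonneg fun y => mul_nonneg (hWc ω).1 (surplus_nonneg _ _ _)
  · simp only
    rw [integral_const_mul]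
    exact mul_le_mul_of_nonneg_left (integral_surplus_le ht (h.stateAt_mem_Icc a i ω)) (hWc ω).1

/-- Whatever the policy, the second moment of the number of selections is at most `4n + √n`. -/
lemma integral_sq_countBefore_le (h : IsUniformStream P 𝓕 Y) {a : Ω → Set ℕ}
    (ha : ∀ i, MeasurableSet[𝓕 (i + 1)] {ω | i ∈ a ω})
    (hf : ∀ ω, ∀ i ∈ a ω, CanFollow (stateAt (fun j => Y j ω) (a ω) i) (Y i ω)) (n : ℕ) :
    ∫ ω, countBefore n (a ω) ^ 2 ∂P ≤ 4 * n + √n := by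
  rcases Nat.eq_zero_or_pos n with rfl | hn
  · simp [countBefore]
  have hsn : 0 < √(n : ℝ) := Real.sqrt_pos.2 (by exact_mod_cast hn)
  have hsq : √(n : ℝ) ^ 2 = n := Real.sq_sqrt (by positivity)
  -- The price at which the mean total surplus `n t² / 2` equals the budget `2`.
  set t : ℝ := 2 / √n with ht
  have ht0 : 0 < t := by positivity
  set Z : ℕ → Ω → ℝ := fun i ω => surplus t (stateAt (fun j => Y j ω) (a ω) i) (Y i ω) with hZ
  set R : ℕ → Ω → ℝ := fun i ω => ∑ j ∈ Finset.range i, Z j ω with hR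
  have hZ0 : ∀ i ω, 0 ≤ Z i ω := fun i ω => surplus_nonneg _ _ _
  have hZt : ∀ i ω, Z i ω ≤ t := fun i ω => surplus_le ht0.le (h.stateAt_mem_Icc a i ω).2
  have hZm : ∀ i, Measurable[𝓕 (i + 1)] (Z i) := fun i =>
    (measurable_surplus t).comp (((h.measurable_stateAt ha i).mono
      (h.mono (Nat.le_succ i)) le_rfl).prodMk (h.measurable i))
  have hRm : ∀ i, Measurable[𝓕 i] (R i) := fun i =>
    Finset.measurable_sum _ fun j hj => (hZm j).mono (h.mono (Finset.mem_range.1 hj)) le_rfl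
  have hRb : ∀ (i : ℕ) ω, R i ω ∈ Set.Icc 0 (i * t) := by
    intro i ω
    refine ⟨Finset.sum_nonneg fun j _ => hZ0 j ω, ?_⟩
    calc R i ω ≤ ∑ j ∈ Finset.range i, t := Finset.sum_le_sum fun j _ => hZt j ω
      _ = i * t := by simp
  have hbdd : ∀ {f : Ω → ℝ} {c : ℝ}, Measurable f → (∀ ω, f ω ∈ Set.Icc 0 c) → Integrable f P := by
    intro f c hfm hfc
    refine Integrable.of_bound (C := c) hfm.aestronglyMeasurable (ae_of_all _ fun ω => ?_)
    rw [Real.norm_of_nonneg (hfc ω).1]; exact (hfc ω).2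
  have hZm' : ∀ i, Measurable (Z i) := fun i => (hZm i).mono (h.le _) le_rfl
  have hRm' : ∀ i, Measurable (R i) := fun i => (hRm i).mono (h.le _) le_rfl
  have hZi : ∀ i, Integrable (Z i) P := fun i => hbdd (hZm' i) fun ω => ⟨hZ0 i ω, hZt i ω⟩
  have hRi : ∀ i, Integrable (R i) P := fun i => hbdd (hRm' i) (hRb i)
  have hRRi : ∀ i, Integrable (fun ω => R i ω ^ 2) P := fun i =>
    hbdd (c := (i * t) ^ 2) ((hRm' i).pow_const 2) fun ω =>
      ⟨sq_nonneg _, pow_le_pow_left₀ (hRb i ω).1 (hRb i ω).2 2⟩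
  have hRZi : ∀ i, Integrable (fun ω => R i ω * Z i ω) P := fun i =>
    hbdd (c := (i * t) * t) ((hRm' i).mul (hZm' i)) fun ω =>
      ⟨mul_nonneg (hRb i ω).1 (hZ0 i ω),
        mul_le_mul (hRb i ω).2 (hZt i ω) (hZ0 i ω) (by positivity)⟩
  have hEZ : ∀ i, ∫ ω, Z i ω ∂P ≤ t ^ 2 / 2 := fun i => by
    simpa using h.integral_mul_surplus_le ha ht0.le (i := i) (W := fun _ => 1) (c := 1)
      measurable_const (by simp)
  have hERZ : ∀ i, ∫ ω, R i ω * Z i ω ∂P ≤ (∫ ω, R i ω ∂P) * (t ^ 2 / 2) := fun i =>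
    h.integral_mul_surplus_le ha ht0.le (hRm i) (hRb i)
  have hER : ∀ i : ℕ, ∫ ω, R i ω ∂P ≤ i * (t ^ 2 / 2) := by
    intro i
    calc ∫ ω, R i ω ∂P = ∑ j ∈ Finset.range i, ∫ ω, Z j ω ∂P :=
          integral_finsetSum _ fun j _ => hZi j
      _ ≤ ∑ j ∈ Finset.range i, t ^ 2 / 2 := Finset.sum_le_sum fun j _ => hEZ j
      _ = i * (t ^ 2 / 2) := by simp
  have hERR : ∀ i : ℕ, ∫ ω, R i ω ^ 2 ∂P ≤ i ^ 2 * (t ^ 4 / 4) + i * (t ^ 3 / 2) := by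
    intro i
    induction i with
    | zero => simp [hR]
    | succ i ih =>
      have hsum : Integrable (fun ω => 2 * (R i ω * Z i ω) + t * Z i ω) P :=
        ((hRZi i).const_mul 2).add ((hZi i).const_mul t)
      have h1 : ∫ ω, R (i + 1) ω ^ 2 ∂P ≤
          ∫ ω, (R i ω ^ 2 + (2 * (R i ω * Z i ω) + t * Z i ω)) ∂P := by
        refine integral_mono (hRRi _) ((hRRi i).add hsum) fun ω => ?_
        have : R (i + 1) ω = R i ω + Z i ω := Finset.sum_range_succ _ _
        simp only [this]
        nlinarith [mul_le_mul_of_nonneg_right (hZt i ω) (hZ0 i ω)]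
      rw [integral_add (hRRi i) hsum,
        integral_add ((hRZi i).const_mul 2) ((hZi i).const_mul t), integral_const_mul,
        integral_const_mul] at h1
      have h2 := mul_le_mul_of_nonneg_left (hEZ i) ht0.le
      have h3 := mul_le_mul_of_nonneg_right (hER i) (by positivity : 0 ≤ t ^ 2 / 2)
      have h4 := hERZ i
      have h5 : 0 ≤ t ^ 4 := by positivity
      push_cast
      nlinarith
  have hpath : ∀ ω, t * countBefore n (a ω) ≤ 2 + R n ω := fun ω =>
    (mul_count_le t (hf ω) n).trans
      (add_le_add_left (used_le_two (h.stateAt_mem_Icc a n ω)) _)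
  have h1 : t ^ 2 * ∫ ω, countBefore n (a ω) ^ 2 ∂P ≤
      4 + (4 * ∫ ω, R n ω ∂P + ∫ ω, R n ω ^ 2 ∂P) := by
    have hsum : Integrable (fun ω => 4 * R n ω + R n ω ^ 2) P :=
      ((hRi n).const_mul 4).add (hRRi n)
    have h2 : ∫ ω, t ^ 2 * countBefore n (a ω) ^ 2 ∂P ≤
        ∫ ω, ((4 : ℝ) + (4 * R n ω + R n ω ^ 2)) ∂P := by
      refine integral_mono_of_nonneg (ae_of_all _ fun ω => by positivity)
        ((integrable_const _).add hsum) (ae_of_all _ fun ω => ?_)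
      have h3 := pow_le_pow_left₀ (mul_nonneg ht0.le (countBefore_mem_Icc n (a ω)).1) (hpath ω) 2
      simp only
      nlinarith
    rw [integral_const_mul, integral_add (integrable_const _) hsum,
      integral_add ((hRi n).const_mul 4) (hRRi n),
      integral_const_mul] at h2
    simpa using h2
  have hnt : (n : ℝ) * t ^ 2 = 4 := by
    rw [ht, div_pow, hsq]; field_simp; norm_num
  have hst : √(n : ℝ) * t = 2 := by rw [ht]; field_simp
  have h2 := hER n
  have h3 := hERR n
  have h4 : (n : ℝ) ^ 2 * (t ^ 4 / 4) = 4 := by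
    have : (n : ℝ) ^ 2 * (t ^ 4 / 4) = (n * t ^ 2) ^ 2 / 4 := by ring
    rw [this, hnt]; norm_num
  have h5 : (n : ℝ) * (t ^ 3 / 2) = 2 * t := by
    have : (n : ℝ) * (t ^ 3 / 2) = (n * t ^ 2) * t / 2 := by ring
    rw [this, hnt]; ring
  have h6 : t ^ 2 * (4 * n + √n) = 16 + 2 * t := by
    have : t ^ 2 * (4 * n + √n) = 4 * (n * t ^ 2) + (√n * t) * t := by ring
    rw [this, hnt, hst]; norm_num
  have h7 : (n : ℝ) * (t ^ 2 / 2) = 2 := by linarith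
  have h8 : t ^ 2 * ∫ ω, countBefore n (a ω) ^ 2 ∂P ≤ t ^ 2 * (4 * n + √n) := by
    rw [h6]; linarith
  exact le_of_mul_le_mul_left h8 (by positivity)

/-! ### Optimality -/

lemma integral_bestGain (h : IsUniformStream P 𝓕 Y) {a : Ω → Set ℕ}
    (ha : ∀ i, MeasurableSet[𝓕 (i + 1)] {ω | i ∈ a ω}) (i k : ℕ) :
    Integrable (fun ω => bestGain (value k) (stateAt (fun j => Y j ω) (a ω) i) (Y i ω)) P ∧
    ∫ ω, bestGain (value k) (stateAt (fun j => Y j ω) (a ω) i) (Y i ω) ∂P =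
      ∫ ω, value (k + 1) (stateAt (fun j => Y j ω) (a ω) i) ∂P := by
  have hσ := h.measurable_stateAt ha i
  have hm : Measurable fun ω => (stateAt (fun j => Y j ω) (a ω) i, Y i ω) :=
    (hσ.mono (h.le i) le_rfl).prodMk ((h.measurable i).mono (h.le _) le_rfl)
  have hint : Integrable
      (fun ω => bestGain (value k) (stateAt (fun j => Y j ω) (a ω) i) (Y i ω)) P := by
    refine Integrable.of_bound (C := k + 1)
      ((measurable_bestGain (measurable_value k)).comp hm).aestronglyMeasurable
      (ae_of_all _ fun ω => ?_)
    have hb := bestGain_mem_Icc (value_mem_Icc k) (stateAt (fun j => Y j ω) (a ω) i) (Y i ω)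
    rw [Real.norm_of_nonneg hb.1]; exact hb.2
  exact ⟨hint, h.integral_comp hσ (measurable_bestGain (measurable_value k)) hint⟩

lemma integrable_countBefore (h : IsUniformStream P 𝓕 Y) {a : Ω → Set ℕ}
    (ha : ∀ i, MeasurableSet[𝓕 (i + 1)] {ω | i ∈ a ω}) (n : ℕ) :
    Integrable (fun ω => countBefore n (a ω)) P := by
  refine Integrable.of_bound (C := n) (h.measurable_countBefore ha n).aestronglyMeasurable
    (ae_of_all _ fun ω => ?_)
  rw [Real.norm_of_nonneg (countBefore_mem_Icc n (a ω)).1]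
  exact (countBefore_mem_Icc n (a ω)).2

lemma integrable_value (h : IsUniformStream P 𝓕 Y) {a : Ω → Set ℕ}
    (ha : ∀ i, MeasurableSet[𝓕 (i + 1)] {ω | i ∈ a ω}) (i k : ℕ) :
    Integrable (fun ω => value k (stateAt (fun j => Y j ω) (a ω) i)) P := by
  refine Integrable.of_bound (C := k) ((measurable_value k).comp
    ((h.measurable_stateAt ha i).mono (h.le i) le_rfl)).aestronglyMeasurable
    (ae_of_all _ fun ω => ?_)
  have hb := value_mem_Icc k (stateAt (fun j => Y j ω) (a ω) i)
  rw [Real.norm_of_nonneg hb.1]; exact hb.2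

open Classical in
lemma countBefore_succ_add_value (y : ℕ → ℝ) (a : Set ℕ) (i k : ℕ) :
    countBefore (i + 1) a + value k (stateAt y a (i + 1)) = countBefore i a +
      if i ∈ a then 1 + value k (advance (stateAt y a i) (y i)) else value k (stateAt y a i) := by
  rw [countBefore, Finset.sum_range_succ, ← countBefore]
  by_cases hi : i ∈ a
  · rw [stateAt_succ_of_mem hi]; simp [hi]; ring
  · rw [stateAt_succ_of_notMem hi]; simp [hi]

/-- The number of selections so far plus the value of the current state is a supermartingale. -/
lemma integral_countBefore_add_value_le (h : IsUniformStream P 𝓕 Y) {a : Ω → Set ℕ}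
    (ha : ∀ i, MeasurableSet[𝓕 (i + 1)] {ω | i ∈ a ω})
    (hf : ∀ ω, ∀ i ∈ a ω, CanFollow (stateAt (fun j => Y j ω) (a ω) i) (Y i ω)) (i k : ℕ) :
    ∫ ω, (countBefore i (a ω) + value k (stateAt (fun j => Y j ω) (a ω) i)) ∂P ≤
      value (i + k) (true, 0) := by
  induction i generalizing k with
  | zero => simp [countBefore, stateAt]
  | succ i ih =>
    obtain ⟨hint, heq⟩ := h.integral_bestGain ha i k
    have hN := h.integrable_countBefore ha
    calc ∫ ω, (countBefore (i + 1) (a ω) + value k (stateAt (fun j => Y j ω) (a ω) (i + 1))) ∂P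
        ≤ ∫ ω, (countBefore i (a ω) +
            bestGain (value k) (stateAt (fun j => Y j ω) (a ω) i) (Y i ω)) ∂P := by
          refine integral_mono ((hN _).add (h.integrable_value ha _ _)) ((hN _).add hint)
            fun ω => ?_
          simp only
          rw [countBefore_succ_add_value]
          refine add_le_add_right ?_ _
          split_ifs with hi
          · refine le_max_of_le_right ?_
            rw [if_pos (hf ω i hi)]
          · exact le_max_left _ _
      _ = ∫ ω, (countBefore i (a ω) + value (k + 1) (stateAt (fun j => Y j ω) (a ω) i)) ∂P := by
          rw [integral_add (hN _) hint, heq, integral_add (hN _) (h.integrable_value ha _ _)]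
      _ ≤ _ := by
          have := ih (k + 1)
          rwa [show i + (k + 1) = i + 1 + k by ring] at this

lemma ae_ne_stateAt (h : IsUniformStream P 𝓕 Y) {a : Ω → Set ℕ}
    (ha : ∀ i, MeasurableSet[𝓕 (i + 1)] {ω | i ∈ a ω}) (i : ℕ) :
    ∀ᵐ ω ∂P, Y i ω ≠ (stateAt (fun j => Y j ω) (a ω) i).2 := by
  have hσ := h.measurable_stateAt ha i
  have hS : MeasurableSet {p : SelState × ℝ | p.2 = p.1.2} :=
    measurableSet_eq_fun measurable_snd (measurable_snd.comp measurable_fst)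
  have hm : Measurable fun ω => (stateAt (fun j => Y j ω) (a ω) i, Y i ω) :=
    (hσ.mono (h.le i) le_rfl).prodMk ((h.measurable i).mono (h.le _) le_rfl)
  have hΦ : Measurable ({p : SelState × ℝ | p.2 = p.1.2}.indicator (1 : SelState × ℝ → ℝ)) :=
    measurable_one.indicator hS
  have hint : Integrable (fun ω => {p : SelState × ℝ | p.2 = p.1.2}.indicator
      (1 : SelState × ℝ → ℝ) (stateAt (fun j => Y j ω) (a ω) i, Y i ω)) P := by
    refine Integrable.of_bound (C := 1) (hΦ.comp hm).aestronglyMeasurable (ae_of_all _ fun ω => ?_)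
    by_cases hc : Y i ω = (stateAt (fun j => Y j ω) (a ω) i).2 <;> simp [Set.indicator, hc]
  have e := h.integral_comp hσ hΦ hint
  have h0 : ∀ σ : SelState, ∫ y in Set.Icc (0 : ℝ) 1, {p : SelState × ℝ | p.2 = p.1.2}.indicator
      (1 : SelState × ℝ → ℝ) (σ, y) = 0 := by
    intro σ
    rw [integral_eq_zero_of_ae]
    filter_upwards [ae_restrict_of_ae (Measure.ae_ne volume σ.2)] with y hy
    simp [hy]
  rw [integral_congr_ae (ae_of_all _ fun ω => h0 _), integral_zero] at e
  rw [integral_eq_zero_iff_of_nonneg (fun ω => Set.indicator_nonneg (by simp) _) hint] at e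
  filter_upwards [e] with ω hω hc
  simp [hc] at hω

end IsUniformStream

/-- The optimal rule with `k` values to come afterwards: select `y` if this is allowed and at least
as good as passing over it. Equality with the last value is excluded, which costs nothing, so that
the selection is also unimodal in any scale of which the present one is a monotone image. -/
def Accept (k : ℕ) (σ : SelState) (y : ℝ) : Prop :=
  CanFollow σ y ∧ y ≠ σ.2 ∧ value k σ ≤ 1 + value k (advance σ y)

open Classical in
/-- The state after the first `i` of `n` places under the optimal rule. -/
noncomputable def bestState (n : ℕ) (y : ℕ → ℝ) : ℕ → SelState
  | 0 => (true, 0)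
  | i + 1 => if Accept (n - 1 - i) (bestState n y i) (y i) then advance (bestState n y i) (y i)
      else bestState n y i

/-- The places that the optimal rule for `n` values selects. -/
def bestChoice (n : ℕ) (y : ℕ → ℝ) : Set ℕ := {i | Accept (n - 1 - i) (bestState n y i) (y i)}

lemma stateAt_bestChoice (n : ℕ) (y : ℕ → ℝ) (i : ℕ) :
    stateAt y (bestChoice n y) i = bestState n y i := by
  induction i with
  | zero => rfl
  | succ i ih => simp only [stateAt, bestState, ih]; rfl

lemma measurableSet_accept (k : ℕ) : MeasurableSet {p : SelState × ℝ | Accept k p.1 p.2} := by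
  refine measurableSet_canFollow.inter (MeasurableSet.inter (s₁ := {p : SelState × ℝ | p.2 ≠ p.1.2})
    (s₂ := {p : SelState × ℝ | value k p.1 ≤ 1 + value k (advance p.1 p.2)}) ?_ ?_)
  · exact (measurableSet_eq_fun measurable_snd (measurable_snd.comp measurable_fst)).compl
  · exact measurableSet_le ((measurable_value k).comp measurable_fst)
      (measurable_const.add ((measurable_value k).comp measurable_advance))

lemma max_eq_of_accept {k : ℕ} {σ : SelState} {y : ℝ} (hy : y ≠ σ.2) [Decidable (Accept k σ y)] :
    (if Accept k σ y then 1 + value k (advance σ y) else value k σ) = bestGain (value k) σ y := by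
  unfold bestGain
  by_cases hc : CanFollow σ y
  · by_cases hv : value k σ ≤ 1 + value k (advance σ y)
    · simp [Accept, hc, hy, hv]
    · simp [Accept, hc, hv, (not_le.1 hv).le]
  · simp [Accept, hc, (value_mem_Icc k σ).1]

namespace IsUniformStream

variable {Ω : Type*} [mΩ : MeasurableSpace Ω] {P : Measure Ω}
  {𝓕 : ℕ → MeasurableSpace Ω} {Y : ℕ → Ω → ℝ}

lemma measurable_bestState (h : IsUniformStream P 𝓕 Y) (n i : ℕ) :
    Measurable[𝓕 i] fun ω => bestState n (fun j => Y j ω) i := by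
  induction i with
  | zero => exact measurable_const
  | succ i ih =>
    have ih' := ih.mono (h.mono (Nat.le_succ i)) le_rfl
    have hp := ih'.prodMk (h.measurable i)
    exact Measurable.ite (hp (measurableSet_accept _)) (measurable_advance.comp hp) ih'

lemma measurableSet_bestChoice (h : IsUniformStream P 𝓕 Y) (n i : ℕ) :
    MeasurableSet[𝓕 (i + 1)] {ω | i ∈ bestChoice n (fun j => Y j ω)} :=
  (((h.measurable_bestState n i).mono (h.mono (Nat.le_succ i)) le_rfl).prodMk (h.measurable i))
    (measurableSet_accept _)

variable [IsProbabilityMeasure P]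

/-- Under the optimal rule the supermartingale is a martingale. -/
lemma integral_countBefore_bestChoice (h : IsUniformStream P 𝓕 Y) (n : ℕ) :
    ∫ ω, countBefore n (bestChoice n fun j => Y j ω) ∂P = value n (true, 0) := by
  classical
  set a : Ω → Set ℕ := fun ω => bestChoice n fun j => Y j ω with hadef
  have ha : ∀ i, MeasurableSet[𝓕 (i + 1)] {ω | i ∈ a ω} := h.measurableSet_bestChoice n
  have hN := h.integrable_countBefore ha
  have key : ∀ i k, i + k = n → ∫ ω, (countBefore i (a ω) +
      value k (stateAt (fun j => Y j ω) (a ω) i)) ∂P = value n (true, 0) := by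
    intro i
    induction i with
    | zero => rintro k rfl; simp [countBefore, stateAt]
    | succ i ih =>
      intro k hk
      obtain ⟨hint, heq⟩ := h.integral_bestGain ha i k
      rw [← ih (k + 1) (by omega),
        integral_add (hN i) (h.integrable_value ha i (k + 1)), ← heq,
        ← integral_add (hN _) hint]
      refine integral_congr_ae ?_
      filter_upwards [h.ae_ne_stateAt ha i] with ω hω
      rw [countBefore_succ_add_value, ← max_eq_of_accept hω]
      have : i ∈ a ω ↔ Accept k (stateAt (fun j => Y j ω) (a ω) i) (Y i ω) := by
        rw [hadef, stateAt_bestChoice]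
        have : n - 1 - i = k := by omega
        simp only [bestChoice, Set.mem_ofPred_eq, this]
      simp only [this]
  simpa [value] using key n 0 rfl

end IsUniformStream

/-! ### Policies for observations with a continuous distribution function -/

/-- The σ-field generated by the observations before the `i`-th one. -/
abbrev pastSigma {Ω : Type*} (X : ℕ → Ω → ℝ) (i : ℕ) : MeasurableSpace Ω :=
  ⨆ j < i, MeasurableSpace.comap (X j) inferInstance

lemma pastSigma_succ {Ω : Type*} (X : ℕ → Ω → ℝ) (i : ℕ) :
    pastSigma X (i + 1) = observedSigma X i := by
  simp only [pastSigma, observedSigma, Nat.lt_succ_iff]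

lemma card_eq_countBefore {n : ℕ} {s : Finset (Fin n)} {a : Set ℕ}
    (hs : ∀ i : Fin n, i ∈ s ↔ (i : ℕ) ∈ a) : (s.card : ℝ) = countBefore n a := by
  classical
  have e : s = Finset.univ.filter fun i : Fin n => (i : ℕ) ∈ a := by ext i; simp [hs]
  rw [countBefore, Finset.sum_range, e, ← Finset.sum_boole]
  rfl

/-- The places that a policy selects, as a set of natural numbers. -/
def chosen {Ω : Type*} {X : ℕ → Ω → ℝ} {n : ℕ} (π : FeasiblePolicy X n) (ω : Ω) : Set ℕ :=
  ((↑) : Fin n → ℕ) '' (π.selected ω : Set (Fin n))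

lemma length_eq_countBefore {Ω : Type*} {X : ℕ → Ω → ℝ} {n : ℕ} (π : FeasiblePolicy X n) (ω : Ω) :
    (π.length ω : ℝ) = countBefore n (chosen π ω) :=
  card_eq_countBefore fun i => by simp [chosen, ← Fin.ext_iff]

lemma measurableSet_chosen {Ω : Type*} {X : ℕ → Ω → ℝ} {n : ℕ} (π : FeasiblePolicy X n) (i : ℕ) :
    MeasurableSet[pastSigma X (i + 1)] {ω | i ∈ chosen π ω} := by
  rw [pastSigma_succ]
  by_cases hi : i < n
  · have e : {ω | i ∈ chosen π ω} = {ω | (⟨i, hi⟩ : Fin n) ∈ π.selected ω} := by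
      ext ω
      simp only [chosen, Set.mem_ofPred_eq, Set.mem_image, Finset.mem_coe]
      exact ⟨fun ⟨j, hj, hji⟩ => by subst hji; exact hj, fun h => ⟨_, h, rfl⟩⟩
    rw [e]
    exact π.nonanticipating ⟨i, hi⟩
  · have e : {ω | i ∈ chosen π ω} = ∅ := by
      ext ω
      simp only [chosen, Set.mem_ofPred_eq, Set.mem_image, Set.mem_empty_iff_false, iff_false]
      rintro ⟨j, -, rfl⟩
      exact hi j.2
    rw [e]
    exact @MeasurableSet.empty _ (_)

section Observations

variable {Ω : Type*} [mΩ : MeasurableSpace Ω] {P : Measure Ω} {X : ℕ → Ω → ℝ} {F : ℝ → ℝ}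
  [IsProbabilityMeasure P]

/-- The probability integral transform. -/
lemma map_cdf_eq_uniform {X : Ω → ℝ} (hX : Measurable X)
    (hF : Continuous F) (hcdf : ∀ x, P.real {ω | X ω ≤ x} = F x) :
    Monotone F ∧ P.map (fun ω => F (X ω)) = volume.restrict (Set.Icc 0 1) := by
  have : IsProbabilityMeasure (P.map X) := Measure.isProbabilityMeasure_map hX.aemeasurable
  have hFc : F = cdf (P.map X) := by
    ext x
    rw [cdf_eq_real, map_measureReal_apply hX measurableSet_Iic]
    exact (hcdf x).symm
  have hmono : Monotone F := by rw [hFc]; exact monotone_cdf _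
  have hF0 : ∀ x, 0 ≤ F x := fun x => by rw [hFc]; exact cdf_nonneg _ x
  have hF1 : ∀ x, F x ≤ 1 := fun x => by rw [hFc]; exact cdf_le_one _ x
  have hFX : Measurable fun ω => F (X ω) := hF.measurable.comp hX
  have hbot : Tendsto F atBot (nhds 0) := by rw [hFc]; exact tendsto_cdf_atBot _
  have htop : Tendsto F atTop (nhds 1) := by rw [hFc]; exact tendsto_cdf_atTop _
  have hivt : ∀ u, 0 < u → u < 1 → ∃ x, F x = u := by
    intro u h0 h1
    obtain ⟨x, hx⟩ := (hbot.eventually (gt_mem_nhds h0)).exists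
    obtain ⟨z, hz⟩ := (htop.eventually (lt_mem_nhds h1)).exists
    exact mem_range_of_exists_le_of_exists_ge hF ⟨x, hx.le⟩ ⟨z, hz.le⟩
  have hupper : ∀ u, 0 < u → u < 1 → P.real {ω | F (X ω) < u} ≤ u := by
    intro u h0 h1
    obtain ⟨x, rfl⟩ := hivt u h0 h1
    refine le_of_le_of_eq (measureReal_mono fun ω hω => ?_) (hcdf x)
    exact (hmono.reflect_lt hω).le
  have hlower : ∀ u, 0 < u → u < 1 → u ≤ P.real {ω | F (X ω) ≤ u} := by
    intro u h0 h1
    obtain ⟨x, rfl⟩ := hivt u h0 h1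
    exact le_of_eq_of_le (hcdf x).symm (measureReal_mono fun ω hω => hmono hω)
  refine ⟨hmono, ?_⟩
  have : IsProbabilityMeasure (P.map fun ω => F (X ω)) :=
    Measure.isProbabilityMeasure_map hFX.aemeasurable
  refine Measure.ext_of_Iic _ _ fun u => ?_
  rw [Measure.map_apply hFX measurableSet_Iic, Measure.restrict_apply measurableSet_Iic]
  rcases lt_or_ge u 0 with hu | hu
  · have e1 : (fun ω => F (X ω)) ⁻¹' Set.Iic u = ∅ := by
      ext ω; simp; linarith [hF0 (X ω)]
    have e2 : Set.Iic u ∩ Set.Icc (0 : ℝ) 1 = ∅ := by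
      ext y; simp; intros; linarith
    rw [e1, e2]; simp
  rcases lt_or_ge u 1 with hu1 | hu1
  · have e2 : Set.Iic u ∩ Set.Icc (0 : ℝ) 1 = Set.Icc 0 u := by
      ext y
      simp only [Set.mem_inter_iff, Set.mem_Iic, Set.mem_Icc]
      exact ⟨fun h => ⟨h.2.1, h.1⟩, fun h => ⟨h.2, h.1, h.2.trans hu1.le⟩⟩
    rw [e2, Real.volume_Icc, sub_zero, ← ofReal_measureReal]
    congr 1
    refine le_antisymm (le_of_forall_gt_imp_ge_of_dense fun w hw => ?_) ?_
    · rcases lt_or_ge w 1 with hw1 | hw1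
      · refine le_trans (measureReal_mono fun ω hω => ?_) (hupper w (hu.trans_lt hw) hw1)
        exact lt_of_le_of_lt hω hw
      · exact measureReal_le_one.trans hw1
    · rcases hu.eq_or_lt with rfl | hu0
      · exact measureReal_nonneg
      · exact hlower u hu0 hu1
  · have e1 : (fun ω => F (X ω)) ⁻¹' Set.Iic u = Set.univ := by
      ext ω; simp; linarith [hF1 (X ω)]
    have e2 : Set.Iic u ∩ Set.Icc (0 : ℝ) 1 = Set.Icc 0 1 := by
      ext y
      simp only [Set.mem_inter_iff, Set.mem_Iic, Set.mem_Icc]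
      exact ⟨fun h => h.2, fun h => ⟨h.2.trans hu1, h⟩⟩
    rw [e1, e2]; simp

/-- In the scale of their distribution function the observations are uniform. -/
lemma isUniformStream (hX : ∀ i, Measurable (X i))
    (hindep : iIndepFun X P) (hF : Continuous F) (hcdf : ∀ i x, P.real {ω | X i ω ≤ x} = F x) :
    IsUniformStream P (pastSigma X) fun i ω => F (X i ω) where
  mono i k hik := biSup_mono fun j hj => lt_of_lt_of_le hj hik
  le i := iSup₂_le fun j _ => (hX j).comap_le
  measurable i := by
    refine hF.measurable.comp ((comap_measurable (X i)).mono ?_ le_rfl)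
    exact le_iSup₂_of_le i (Nat.lt_succ_self i) le_rfl
  indep i := by
    have h1 := indep_iSup_of_disjoint (fun j => (hX j).comap_le) hindep.iIndep
      (S := {j | j < i}) (T := {i}) (by simp)
    refine indep_of_indep_of_le_right h1 ?_
    have h2 : Measurable[MeasurableSpace.comap (X i) inferInstance] fun ω => F (X i ω) :=
      hF.measurable.comp (comap_measurable (X i))
    refine h2.comap_le.trans ?_
    simp
  law i := (map_cdf_eq_uniform (hX i) hF (hcdf i)).2
  mem_Icc i ω := by
    rw [← hcdf i]
    exact ⟨measureReal_nonneg, measureReal_le_one⟩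

lemma canFollow_chosen (hX : ∀ i, Measurable (X i)) (hF : Continuous F)
    (hcdf : ∀ i x, P.real {ω | X i ω ≤ x} = F x) {n : ℕ} (π : FeasiblePolicy X n) (ω : Ω) (i : ℕ)
    (hi : i ∈ chosen π ω) :
    CanFollow (stateAt (fun j => F (X j ω)) (chosen π ω) i) (F (X i ω)) := by
  have hmono := (map_cdf_eq_uniform (hX 0) hF (hcdf 0)).1
  refine canFollow_of_isUnimodalOn (y := fun j => F (X j ω)) (fun j => ?_) (fun hne => ?_) hi
  · simp only [← hcdf j]; exact measureReal_nonneg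
  · obtain ⟨t, ht, h1, h2⟩ := π.unimodal ω hne
    exact ⟨t, ht, hmono.comp_monotoneOn h1, hmono.comp_antitoneOn h2⟩

lemma integral_length_le (hX : ∀ i, Measurable (X i)) (hindep : iIndepFun X P) (hF : Continuous F)
    (hcdf : ∀ i x, P.real {ω | X i ω ≤ x} = F x) {n : ℕ} (π : FeasiblePolicy X n) :
    ∫ ω, (π.length ω : ℝ) ∂P ≤ value n (true, 0) := by
  have h := (isUniformStream hX hindep hF hcdf).integral_countBefore_add_value_le
    (measurableSet_chosen π) (canFollow_chosen hX hF hcdf π) n 0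
  simpa [length_eq_countBefore, value] using h

lemma exists_integral_length_eq (hX : ∀ i, Measurable (X i)) (hindep : iIndepFun X P)
    (hF : Continuous F) (hcdf : ∀ i x, P.real {ω | X i ω ≤ x} = F x) (n : ℕ) :
    ∃ π : FeasiblePolicy X n, ∫ ω, (π.length ω : ℝ) ∂P = value n (true, 0) := by
  classical
  have h := isUniformStream hX hindep hF hcdf
  have hmono := (map_cdf_eq_uniform (hX 0) hF (hcdf 0)).1
  refine ⟨⟨fun ω => Finset.univ.filter fun i : Fin n =>
    (i : ℕ) ∈ bestChoice n fun j => F (X j ω), fun i => ?_, fun ω => ?_⟩, ?_⟩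
  · have hm := h.measurableSet_bestChoice n i
    rw [pastSigma_succ] at hm
    simpa using hm
  · refine isUnimodalOn_of_canFollow (x := fun j => X j ω) (y := fun j => F (X j ω))
      (a := bestChoice n fun j => F (X j ω)) (fun j => (h.mem_Icc j ω).1)
      (fun i j hij => hmono.reflect_lt hij) (fun i hi => ?_) (fun i => by simp)
    rw [stateAt_bestChoice]
    exact ⟨hi.1, hi.2.1⟩
  · rw [← h.integral_countBefore_bestChoice n]
    congr 1
    ext ω
    exact card_eq_countBefore fun i => by simp

/-- The second moment of `U / √n - 2` is small if the mean of `U` is nearly `2 √n`. -/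
lemma integral_sq_sub_two_le (hX : ∀ i, Measurable (X i)) (hindep : iIndepFun X P)
    (hF : Continuous F) (hcdf : ∀ i x, P.real {ω | X i ω ≤ x} = F x) {n : ℕ} (hn : 0 < n)
    (π : FeasiblePolicy X n) {ε : ℝ} (hπ : (2 - ε) * √n ≤ ∫ ω, (π.length ω : ℝ) ∂P) :
    Integrable (fun ω => ((π.length ω : ℝ) / √n - 2) ^ 2) P ∧
      ∫ ω, ((π.length ω : ℝ) / √n - 2) ^ 2 ∂P ≤ 1 / √n + 4 * ε := by
  have h := isUniformStream hX hindep hF hcdf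
  have hm := measurableSet_chosen π
  have h2 := h.integral_sq_countBefore_le hm (canFollow_chosen hX hF hcdf π) n
  have hi := h.integrable_countBefore hm n
  have hi2 : Integrable (fun ω => countBefore n (chosen π ω) ^ 2) P := by
    refine Integrable.of_bound (C := (n : ℝ) ^ 2)
      ((h.measurable_countBefore hm n).pow_const 2).aestronglyMeasurable (ae_of_all _ fun ω => ?_)
    have hb := countBefore_mem_Icc n (chosen π ω)
    rw [Real.norm_of_nonneg (sq_nonneg _)]
    exact pow_le_pow_left₀ hb.1 hb.2 2
  simp only [length_eq_countBefore] at hπ ⊢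
  have hs : 0 < √(n : ℝ) := Real.sqrt_pos.2 (by exact_mod_cast hn)
  have hsq : √(n : ℝ) ^ 2 = n := Real.sq_sqrt (by positivity)
  have e : ∀ ω, (countBefore n (chosen π ω) / √n - 2) ^ 2 =
      1 / √n ^ 2 * countBefore n (chosen π ω) ^ 2 -
        (4 / √n * countBefore n (chosen π ω) - 4) := by
    intro ω; field_simp; ring
  have hi3 : Integrable (fun ω => 4 / √n * countBefore n (chosen π ω) - 4) P :=
    (hi.const_mul _).sub (integrable_const _)
  simp only [e]
  refine ⟨(hi2.const_mul _).sub hi3, ?_⟩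
  rw [integral_sub (hi2.const_mul _) hi3, integral_sub (hi.const_mul _) (integrable_const _),
    integral_const_mul, integral_const_mul]
  have h3 : 1 / √n ^ 2 * ∫ ω, countBefore n (chosen π ω) ^ 2 ∂P ≤ 4 + 1 / √n := by
    have h4 := mul_le_mul_of_nonneg_left h2 (by positivity : 0 ≤ 1 / √(n : ℝ) ^ 2)
    have h5 : 1 / √n ^ 2 * (4 * n + √n) = 4 + 1 / √n := by
      have : 4 * (n : ℝ) + √n = 4 * √n ^ 2 + √n := by rw [hsq]
      rw [this]; field_simp
    linarith
  have h6 : 4 * (2 - ε) ≤ 4 / √n * ∫ ω, countBefore n (chosen π ω) ∂P := by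
    have h7 := mul_le_mul_of_nonneg_left hπ (by positivity : 0 ≤ 4 / √(n : ℝ))
    have h8 : 4 / √n * ((2 - ε) * √n) = 4 * (2 - ε) := by field_simp
    linarith
  simp only [integral_const, probReal_univ, smul_eq_mul, one_mul]
  linarith

end Observations

end UnimodalSelection

/-! ### The weak law -/

open UnimodalSelection

theorem mainTheorem3 {Ω : Type*} [MeasurableSpace Ω] (P : Measure Ω) [IsProbabilityMeasure P]
    (X : ℕ → Ω → ℝ) (hX : ∀ i, Measurable (X i)) (hindep : iIndepFun X P)
    (F : ℝ → ℝ) (hF : Continuous F) (hcdf : ∀ i x, P.real {ω | X i ω ≤ x} = F x) :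
    (∀ n : ℕ, ∃ π : FeasiblePolicy X n, π.IsOptimal P) ∧
    ∀ π : (n : ℕ) → FeasiblePolicy X n, (∀ n, (π n).IsOptimal P) →
      TendstoInMeasure P (fun n ω => ((π n).length ω : ℝ) / Real.sqrt (n : ℝ)) atTop
        (fun _ => (2 : ℝ)) := by
  refine ⟨fun n => ?_, fun π hπ => ?_⟩
  · obtain ⟨π, h⟩ := exists_integral_length_eq hX hindep hF hcdf n
    exact ⟨π, fun ρ => h ▸ integral_length_le hX hindep hF hcdf ρ⟩
  have hval : ∀ n, value n (true, 0) ≤ ∫ ω, ((π n).length ω : ℝ) ∂P := fun n => by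
    obtain ⟨ρ, h⟩ := exists_integral_length_eq hX hindep hF hcdf n
    exact h ▸ hπ n ρ
  rw [tendstoInMeasure_iff_measureReal_norm]
  intro η hη
  rw [Metric.tendsto_atTop']
  intro ε hε
  -- Chebyshev's inequality loses a factor `η ^ 2`.
  set κ : ℝ := ε * η ^ 2 / 8 with hκ
  have hκ0 : 0 < κ := by positivity
  have hlim : Tendsto (fun n : ℕ => √(n : ℝ)) atTop atTop :=
    Real.tendsto_sqrt_atTop.comp tendsto_natCast_atTop_atTop
  have hev := ((eventually_le_value hκ0).and (hlim.eventually_gt_atTop (1 / κ))).and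
    (eventually_gt_atTop 0)
  obtain ⟨N, hN⟩ := eventually_atTop.1 hev
  refine ⟨N, fun n hn => ?_⟩
  obtain ⟨⟨h1, h2⟩, h3⟩ := hN n hn.le
  obtain ⟨hi, hle⟩ := integral_sq_sub_two_le hX hindep hF hcdf h3 (π n) (h1.trans (hval n))
  have hmk := mul_meas_ge_le_integral_of_nonneg (ae_of_all _ fun ω => sq_nonneg _) hi (η ^ 2)
  have hset : {ω | η ≤ ‖((π n).length ω : ℝ) / √(n : ℝ) - 2‖} =
      {ω | η ^ 2 ≤ (((π n).length ω : ℝ) / √(n : ℝ) - 2) ^ 2} := by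
    ext ω
    simp only [Set.mem_ofPred_eq, Real.norm_eq_abs]
    rw [← sq_abs (_ - 2), pow_le_pow_iff_left₀ hη.le (abs_nonneg _) two_ne_zero]
  rw [hset, Real.dist_eq, sub_zero, abs_of_nonneg measureReal_nonneg]
  have hinv : 1 / √(n : ℝ) < κ := by
    have hs : 0 < √(n : ℝ) := (by positivity : 0 < 1 / κ).trans h2
    rw [div_lt_iff₀ hκ0] at h2
    rw [div_lt_iff₀ hs]; linarith
  have hη2 : 0 < η ^ 2 := by positivity
  have : η ^ 2 * P.real {ω | η ^ 2 ≤ (((π n).length ω : ℝ) / √(n : ℝ) - 2) ^ 2} < η ^ 2 * ε := by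
    have : 8 * κ = η ^ 2 * ε := by rw [hκ]; ring
    linarith
  exact lt_of_mul_lt_mul_left this hη2.le
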